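/- Let $E$ be a set of events. A CES (event structure with circular causality) $\mathcal E=\langle \#,\vdash,\Vdash\rangle$ over $E$ consists of an irreflexive symmetric conflict relation $\#\subseteq E\times E$ and relations $\vdash,\Vdash\;\subseteq \mathit{Con}\times E$, where $\mathit{Con}$ is the set of finite conflict-free subsets of $E$ (those containing no $e,e'$ with $e\#e'$). Both relations are saturated: for $\circ\in\{\vdash,\Vdash\}$, if $Y\in\mathit{Con}$, $X\subseteq Y$ and $X\circ e$, then $Y\circ e$. For an infinite conflict-free $S\subseteq E$, $S\circ e$ means that $Y\circ e$ for some finite $Y\subseteq S$. For a finite sequence $\sigma$, $\overline{\sigma}$ is the set of its elements; a finite play is a finite sequence $\sigma$ without repetitions such that $\overline\sigma$ is conflict-free. For $\eta=\langle e_0\cdots e_{n-1}\rangle$ let $$\Gamma(\eta)=\{e_i \mid \{e_0,\dots,e_{i-1}\}\not\vdash e_i \text{ and } \overline{\eta}\not\Vdash e_i\}.$$ For $X\subseteq E$ let $$\mathcal R_{\mathcal E}(X)=\{e\notin X\mid \text{there is a finite play } \sigma\eta \text{ with } \overline\sigma=X,\ e\in\overline\eta,\ \Gamma(\sigma\eta)\subseteq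 X\},$$ and let the set of prudent events of $\mathcal E$ at $X$ be $$\mathcal P_{\mathcal E}(X)=\{e\notin X\mid X\vdash e \text{ or } X\cup \mathcal R_{\mathcal E}(X)\Vdash e\}.$$ A Horn PCL (Propositional Contract Logic) theory $\Delta$ over the atoms $E$ is a set of clauses $\bigwedge\alpha\to a$ and $\bigwedge\alpha\twoheadrightarrow a$ with $\alpha\subseteq E$ finite and $a\in E$; an atom $a$ stands for the clause $\top\to a$. Let $\sigma\eta$ denote the concatenation of the finite sequences $\sigma,\eta$ and $\sigma\mid\eta$ the set of their interleavings, in both cases keeping only the leftmost occurrence of each element. The sets $[\![\Delta]\!]$ of proof traces are the least ones such that, for every $\Delta$: (i) the empty sequence is in $[\![\Delta]\!]$; (ii) if $(\bigwedge\alpha\to a)\in\Delta$, $\sigma\in[\![\Delta]\!]$ and $\alpha\subseteq\overline\sigma$, then $\sigma a\in[\![\Delta]\!]$; (iii) if $(\bigwedge\alpha\twoheadrightarrow a)\in\Delta$, $\sigma\in[\![\Delta\cup\{a\}]\!]$ and $\alpha\subseteq\overline\sigma$, then $(\sigma\mid a)\subseteq[\![\Delta]\!]$. The set of urgent atoms of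 $\Delta$ at $X\subseteq E$ is $$\mathcal U_\Delta(X)=\{a\notin X\mid \exists \sigma,\sigma'.\ \overline\sigma=X \text{ and } \sigma a\sigma'\in[\![\Delta\cup X]\!]\}.$$ Write $\Delta\sim\mathcal E$ if $\#$ is empty and $\Delta=\{\bigwedge X\to e\mid X\vdash e\}\cup\{\bigwedge X\twoheadrightarrow e\mid X\Vdash e\}$. **Lemma.** If $\Delta\sim\mathcal E$, then $\mathcal P_{\mathcal E}(X)=\mathcal U_\Delta(X)$ for every finite set $X\subseteq E$. -/

import Mathlib

/-- The set of elements occurring in a finite sequence. -/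
def mkset {E : Type*} (σ : List E) : Set E := {x | x ∈ σ}

/-! ### Event structures with circular causality -/

/-- `S` is conflict-free with respect to the conflict relation `r`. -/
def ConflictFreeSet {E : Type*} (r : E → E → Prop) (S : Set E) : Prop :=
  ∀ x ∈ S, ∀ y ∈ S, ¬ r x y

/-- An event structure with circular causality (CES) over the events `E`. -/
structure CES (E : Type*) where
  /-- the conflict relation -/
  conflict : E → E → Prop
  /-- the enabling relation, between finite conflict-free sets of events and events -/
  enab : Finset E → E → Prop
  /-- the circular enabling relation, between finite conflict-free sets of events and events -/
  cenab : Finset E → E → Prop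
  conflict_irrefl : ∀ x, ¬ conflict x x
  conflict_symm : ∀ x y, conflict x y → conflict y x
  enab_con : ∀ X e, enab X e → ConflictFreeSet conflict (X : Set E)
  cenab_con : ∀ X e, cenab X e → ConflictFreeSet conflict (X : Set E)
  enab_saturated : ∀ (X Y : Finset E) (e : E), X ⊆ Y → enab X e →
    ConflictFreeSet conflict (Y : Set E) → enab Y e
  cenab_saturated : ∀ (X Y : Finset E) (e : E), X ⊆ Y → cenab X e →
    ConflictFreeSet conflict (Y : Set E) → cenab Y e

namespace CES

variable {E : Type*} (𝓔 : CES E)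

/-- A CES is conflict-free when its conflict relation is empty. -/
def IsConflictFree : Prop := ∀ x y, ¬ 𝓔.conflict x y

/-- The enabling relation on arbitrary sets of events: a conflict-free set enables what one of its
finite subsets enables. On finite sets this is the relation `enab` itself
(see `enables_coe_iff`). -/
def Enables (S : Set E) (e : E) : Prop :=
  ConflictFreeSet 𝓔.conflict S ∧ ∃ Y : Finset E, (Y : Set E) ⊆ S ∧ 𝓔.enab Y e

/-- The circular enabling relation on arbitrary sets of events; on finite sets this is the
relation `cenab` itself (see `cenables_coe_iff`). -/
def CEnables (S : Set E) (e : E) : Prop :=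
  ConflictFreeSet 𝓔.conflict S ∧ ∃ Y : Finset E, (Y : Set E) ⊆ S ∧ 𝓔.cenab Y e

theorem enables_coe_iff (X : Finset E) (e : E) :
    𝓔.Enables (X : Set E) e ↔ 𝓔.enab X e := by
  constructor
  · rintro ⟨hX, Y, hY, h⟩
    exact 𝓔.enab_saturated Y X e (Finset.coe_subset.mp hY) h hX
  · intro h
    exact ⟨𝓔.enab_con X e h, X, subset_rfl, h⟩

theorem cenables_coe_iff (X : Finset E) (e : E) :
    𝓔.CEnables (X : Set E) e ↔ 𝓔.cenab X e := by
  constructor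
  · rintro ⟨hX, Y, hY, h⟩
    exact 𝓔.cenab_saturated Y X e (Finset.coe_subset.mp hY) h hX
  · intro h
    exact ⟨𝓔.cenab_con X e h, X, subset_rfl, h⟩

/-- A finite play: a conflict-free sequence of events without repetitions. -/
def IsPlay (σ : List E) : Prop :=
  σ.Nodup ∧ ConflictFreeSet 𝓔.conflict (mkset σ)

/-- The credits of a finite sequence: the events that occur in it at some position, and are
neither enabled by the events at the earlier positions, nor circularly enabled by the events of
the whole sequence. -/
def credits (η : List E) : Set E :=
  {e | ∃ (i : ℕ) (hi : i < η.length), η[i] = e ∧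
    ¬ 𝓔.Enables (mkset (η.take i)) e ∧ ¬ 𝓔.CEnables (mkset η) e}

/-- The events reachable with past `X`: those outside `X` that occur in some play `σ η`
where `σ` is a linearization of `X` and all credits of `σ η` belong to `X`. -/
def reachable (X : Set E) : Set E :=
  {e | e ∉ X ∧ ∃ σ η : List E, 𝓔.IsPlay (σ ++ η) ∧ mkset σ = X ∧ e ∈ mkset η ∧
    𝓔.credits (σ ++ η) ⊆ X}

/-- The prudent events at `X`. -/
def prudent (X : Set E) : Set E :=
  {e | e ∉ X ∧ (𝓔.Enables X e ∨ 𝓔.CEnables (X ∪ 𝓔.reachable X) e)}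

end CES

/-! ### Horn theories of propositional contract logic and their proof traces -/

/-- Horn clauses: `imp α a` is the implication `⋀ α → a`, and `cimp α a` the contractual
implication `⋀ α ↠ a`, where `⋀ α` is the conjunction of a finite set `α` of atoms (`⊤` when
`α` is empty). -/
inductive HornClause (E : Type*) where
  | imp (α : Finset E) (a : E) : HornClause E
  | cimp (α : Finset E) (a : E) : HornClause E

/-- Horn theories are sets of Horn clauses. -/
abbrev HornTheory (E : Type*) := Set (HornClause E)

/-- The atom `a`, seen as the Horn clause `⊤ → a`. -/
def HornClause.fact {E : Type*} (a : E) : HornClause E := HornClause.imp ∅ a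

namespace HornTheory

variable {E : Type*}

open Classical in
/-- Removal of duplicates from the right: of each element the leftmost occurrence is kept. -/
noncomputable def dedupRight (l : List E) : List E := l.reverse.dedup.reverse

/-- `Shuffle σ η τ`: the sequence `τ` is obtained by interleaving `σ` and `η`
(before duplicates are removed). -/
inductive Shuffle : List E → List E → List E → Prop
  | nil : Shuffle [] [] []
  | left (x : E) {σ η τ : List E} : Shuffle σ η τ → Shuffle (x :: σ) η (x :: τ)
  | right (x : E) {σ η τ : List E} : Shuffle σ η τ → Shuffle σ (x :: η) (x :: τ)

/-- Concatenation, with duplicates removed from the right. -/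
noncomputable def concat (σ η : List E) : List E := dedupRight (σ ++ η)

/-- The set `σ ∣ η` of interleavings, with duplicates removed from the right. -/
def interleavings (σ η : List E) : Set (List E) :=
  {ρ | ∃ τ, Shuffle σ η τ ∧ ρ = dedupRight τ}

/-- `ProofTrace Δ σ`: the sequence `σ` is a proof trace of the Horn theory `Δ`. -/
inductive ProofTrace : HornTheory E → List E → Prop
  | nil (Δ : HornTheory E) : ProofTrace Δ []
  | imp {Δ : HornTheory E} {α : Finset E} {a : E} {σ : List E} :
      HornClause.imp α a ∈ Δ → ProofTrace Δ σ → (α : Set E) ⊆ mkset σ →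
      ProofTrace Δ (concat σ [a])
  | cimp {Δ : HornTheory E} {α : Finset E} {a : E} {σ τ : List E} :
      HornClause.cimp α a ∈ Δ → ProofTrace (Δ ∪ {HornClause.fact a}) σ →
      (α : Set E) ⊆ mkset σ → τ ∈ interleavings σ [a] → ProofTrace Δ τ

/-- The atoms that are urgent in `Δ` at `X`. -/
def urgent (Δ : HornTheory E) (X : Set E) : Set E :=
  {a | a ∉ X ∧ ∃ σ σ' : List E, mkset σ = X ∧
    ProofTrace (Δ ∪ HornClause.fact '' X) (σ ++ [a] ++ σ')}

/-- The relation `Δ ∼ 𝓔` between Horn theories and conflict-free CES: the clauses of `Δ` are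
exactly `⋀ X → e` for the enablings, and `⋀ X ↠ e` for the circular enablings of `𝓔`. -/
def Corresponds (Δ : HornTheory E) (𝓔 : CES E) : Prop :=
  𝓔.IsConflictFree ∧
    Δ = {c | ∃ X e, 𝓔.enab X e ∧ c = HornClause.imp X e} ∪
      {c | ∃ X e, 𝓔.cenab X e ∧ c = HornClause.cimp X e}

end HornTheory

namespace HornTheory

variable {E : Type*}

/-! Both notions reduce to one condition on sequences. Call a sequence justified when each element
is derived by an implication from what precedes it, or contractually from the whole sequence. Proof
traces are exactly the duplicate-free justified sequences (`proofTrace_iff`). Without conflicts, a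
play has its credits in `X` exactly when it is justified once the atoms of `X` are added as facts
(`Corresponds.credits_subset_iff`). If `σ a σ'` is a trace witnessing urgency, it is also a play
showing that its elements outside `X` are reachable, so whatever justifies `a` in it makes `a`
prudent. Conversely, if `a` is prudent through a finite set `Y` of premises, each reachable premise
has its own play; the plays are appended to `σ a` and duplicates removed. Justification survives
because it is monotone in the available premises (`exists_justified_extension`). -/

theorem mkset_append (l r : List E) : mkset (l ++ r) = mkset l ∪ mkset r := by
  ext; simp [mkset]

theorem exists_nodup_mkset_eq (s : Set E) (hs : s.Finite) : ∃ l : List E, l.Nodup ∧ mkset l = s := by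
  refine ⟨hs.toFinset.toList, Finset.nodup_toList _, ?_⟩
  ext; simp [mkset]

/-! ### Removal of duplicates -/

theorem mem_dedupRight {l : List E} {x : E} : x ∈ dedupRight l ↔ x ∈ l := by
  simp [dedupRight]

theorem mkset_dedupRight (l : List E) : mkset (dedupRight l) = mkset l := by
  ext; exact mem_dedupRight

theorem nodup_dedupRight (l : List E) : (dedupRight l).Nodup := by
  classical
  simpa [dedupRight] using List.nodup_dedup _

theorem dedupRight_of_nodup {l : List E} (h : l.Nodup) : dedupRight l = l := by
  classical
  rw [dedupRight, (List.nodup_reverse.mpr h).dedup, List.reverse_reverse]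

theorem dedupRight_concat_of_mem {l : List E} {x : E} (h : x ∈ l) :
    dedupRight (l ++ [x]) = dedupRight l := by
  classical
  simp [dedupRight, List.dedup_cons_of_mem (List.mem_reverse.mpr h)]

theorem dedupRight_concat_of_notMem {l : List E} {x : E} (h : x ∉ l) :
    dedupRight (l ++ [x]) = dedupRight l ++ [x] := by
  classical
  simp [dedupRight, List.dedup_cons_of_notMem (mt List.mem_reverse.mp h)]

/-- Guarantees that a prefix `σ a` keeps the shape required by `urgent` when the rest is cleaned up.
-/
theorem dedupRight_append_of_nodup {l r : List E} (h : l.Nodup) :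
    ∃ r', dedupRight (l ++ r) = l ++ r' := by
  induction r using List.reverseRecOn with
  | nil => exact ⟨[], by simpa using dedupRight_of_nodup h⟩
  | append_singleton r x ih =>
    obtain ⟨r', hr⟩ := ih
    rw [← List.append_assoc]
    by_cases hx : x ∈ l ++ r
    · exact ⟨r', by rw [dedupRight_concat_of_mem hx, hr]⟩
    · exact ⟨r' ++ [x], by rw [dedupRight_concat_of_notMem hx, hr, List.append_assoc]⟩

theorem Shuffle.eq_of_nil {σ τ : List E} (h : Shuffle σ [] τ) : τ = σ := by
  generalize hη : ([] : List E) = η at h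
  induction h with
  | nil => rfl
  | left x _ ih => rw [ih hη]
  | right => cases hη

theorem Shuffle.exists_split {σ τ : List E} {a : E} (h : Shuffle σ [a] τ) :
    ∃ l r, σ = l ++ r ∧ τ = l ++ a :: r := by
  generalize hη : [a] = η at h
  induction h with
  | nil => cases hη
  | left x _ ih =>
    obtain ⟨l, r, rfl, rfl⟩ := ih hη
    exact ⟨x :: l, r, rfl, rfl⟩
  | right x h =>
    cases hη
    exact ⟨[], _, rfl, by rw [h.eq_of_nil]; rfl⟩

theorem shuffle_concat (σ : List E) (a : E) : Shuffle σ [a] (σ ++ [a]) := by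
  induction σ with
  | nil => exact .right a .nil
  | cons x σ ih => exact .left x ih

/-! ### The elements preceding the first occurrence of an element -/

open Classical in
/-- The set of elements that occur in `l` before the first occurrence of `e`. -/
def preceding (l : List E) (e : E) : Set E := mkset (l.takeWhile (· ≠ e))

theorem preceding_append_of_mem {l : List E} {e : E} (h : e ∈ l) (r : List E) :
    preceding (l ++ r) e = preceding l e := by
  induction l with
  | nil => cases h
  | cons x l ih =>
    by_cases hx : x = e
    · simp [preceding, hx]
    · have := ih ((List.mem_cons.mp h).resolve_left (Ne.symm hx))
      simp only [preceding, mkset, Set.ext_iff, Set.mem_ofPred_eq] at this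
      ext y
      simpa [preceding, hx, mkset] using or_congr_right (a := y = x) (this y)

theorem preceding_append_of_notMem {l : List E} {e : E} (h : e ∉ l) (r : List E) :
    preceding (l ++ r) e = mkset l ∪ preceding r e := by
  classical
  rw [preceding, List.takeWhile_append_of_pos, mkset_append]
  · rfl
  · intro x hx
    simpa using fun hxe : x = e => h (hxe ▸ hx)

theorem preceding_cons_self (e : E) (r : List E) : preceding (e :: r) e = ∅ := by
  simp [preceding, mkset]

theorem preceding_append_cons {l : List E} {e : E} (h : e ∉ l) (r : List E) :
    preceding (l ++ e :: r) e = mkset l := by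
  rw [preceding_append_of_notMem h, preceding_cons_self, Set.union_empty]

theorem preceding_subset_append (l r : List E) (e : E) :
    preceding l e ⊆ preceding (l ++ r) e := by
  by_cases h : e ∈ l
  · rw [preceding_append_of_mem h]
  · rw [preceding_append_of_notMem h]
    exact fun x hx => Or.inl ((List.takeWhile_sublist _).subset hx)

/-- The case `e = a` must be excluded: the inserted `a` may become its own first occurrence and lose
predecessors. -/
theorem preceding_subset_insert (l r : List E) {e a : E} (hea : e ≠ a) :
    preceding (l ++ r) e ⊆ preceding (l ++ a :: r) e := by
  by_cases h : e ∈ l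
  · rw [preceding_append_of_mem h, preceding_append_of_mem h]
  · have ha : e ∉ [a] := by simpa using hea
    rw [preceding_append_of_notMem h, preceding_append_of_notMem h, ← List.singleton_append,
      preceding_append_of_notMem ha]
    exact Set.union_subset_union_right _ Set.subset_union_right

/-- Deduplication keeps leftmost occurrences, so sequences can be merged with repetitions and
cleaned up once at the end. -/
theorem preceding_dedupRight (l : List E) {e : E} (he : e ∈ l) :
    preceding (dedupRight l) e = preceding l e := by
  induction l using List.reverseRecOn with
  | nil => cases he
  | append_singleton l x ih =>
    by_cases hl : e ∈ l
    · rw [preceding_append_of_mem hl]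
      by_cases hx : x ∈ l
      · rw [dedupRight_concat_of_mem hx, ih hl]
      · rw [dedupRight_concat_of_notMem hx, preceding_append_of_mem (mem_dedupRight.mpr hl), ih hl]
    · obtain rfl : e = x := by simpa [hl] using he
      rw [dedupRight_concat_of_notMem hl, preceding_append_of_notMem hl,
        preceding_append_of_notMem (mt mem_dedupRight.mp hl), mkset_dedupRight]

theorem preceding_getElem {l : List E} (hl : l.Nodup) (i : ℕ) (hi : i < l.length) :
    preceding l l[i] = mkset (l.take i) := by
  have h : l.take i ++ l[i] :: l.drop (i + 1) = l := by simp
  have hn : l[i] ∉ l.take i := by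
    intro hm
    rw [← h] at hl
    exact (List.nodup_append.mp hl).2.2 _ hm _ List.mem_cons_self rfl
  conv_lhs => arg 1; rw [← h]
  exact preceding_append_cons hn _

/-! ### Justified sequences -/

/-- `e` is the conclusion of an implication in `Δ` whose premises lie in `S`. -/
def Derives (Δ : HornTheory E) (S : Set E) (e : E) : Prop :=
  ∃ α : Finset E, HornClause.imp α e ∈ Δ ∧ (α : Set E) ⊆ S

/-- `e` is the conclusion of a contractual implication in `Δ` whose premises lie in `S`. -/
def CDerives (Δ : HornTheory E) (S : Set E) (e : E) : Prop :=
  ∃ α : Finset E, HornClause.cimp α e ∈ Δ ∧ (α : Set E) ⊆ S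

/-- Each element of `σ` is derived from what precedes it, or contractually derived from all
of `σ`. -/
def Justified (Δ : HornTheory E) (σ : List E) : Prop :=
  ∀ e ∈ σ, Derives Δ (preceding σ e) e ∨ CDerives Δ (mkset σ) e

theorem Derives.mono {Δ : HornTheory E} {S T : Set E} {e : E} (h : Derives Δ S e) (hST : S ⊆ T) :
    Derives Δ T e :=
  let ⟨α, hα, hs⟩ := h
  ⟨α, hα, hs.trans hST⟩

theorem CDerives.mono {Δ : HornTheory E} {S T : Set E} {e : E} (h : CDerives Δ S e)
    (hST : S ⊆ T) : CDerives Δ T e :=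
  let ⟨α, hα, hs⟩ := h
  ⟨α, hα, hs.trans hST⟩

theorem derives_union_facts {Δ : HornTheory E} {X S : Set E} {e : E} :
    Derives (Δ ∪ HornClause.fact '' X) S e ↔ e ∈ X ∨ Derives Δ S e := by
  constructor
  · rintro ⟨α, hα | ⟨x, hx, hxe⟩, hs⟩
    · exact .inr ⟨α, hα, hs⟩
    · cases hxe
      exact .inl hx
  · rintro (he | ⟨α, hα, hs⟩)
    · exact ⟨∅, .inr ⟨e, he, rfl⟩, by simp⟩
    · exact ⟨α, .inl hα, hs⟩

theorem cderives_union_facts {Δ : HornTheory E} {X S : Set E} {e : E} :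
    CDerives (Δ ∪ HornClause.fact '' X) S e ↔ CDerives Δ S e := by
  constructor
  · rintro ⟨α, hα | ⟨x, hx, hxe⟩, hs⟩
    · exact ⟨α, hα, hs⟩
    · cases hxe
  · rintro ⟨α, hα, hs⟩
    exact ⟨α, .inl hα, hs⟩

theorem Justified.dedupRight {Δ : HornTheory E} {σ : List E} (h : Justified Δ σ) :
    Justified Δ (dedupRight σ) := by
  intro e he
  rw [mem_dedupRight] at he
  rw [preceding_dedupRight σ he, mkset_dedupRight]
  exact h e he

theorem justified_of_proofTrace {Δ : HornTheory E} {σ : List E} (h : ProofTrace Δ σ) :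
    σ.Nodup ∧ Justified Δ σ := by
  induction h with
  | nil => exact ⟨List.nodup_nil, fun e he => by cases he⟩
  | @imp Δ α a σ hα _ hs ih =>
    refine ⟨nodup_dedupRight _, Justified.dedupRight fun e he => ?_⟩
    by_cases heσ : e ∈ σ
    · refine (ih.2 e heσ).imp (·.mono (preceding_subset_append _ _ _)) (·.mono ?_)
      rw [mkset_append]
      exact Set.subset_union_left
    · obtain rfl : e = a := by simpa [heσ] using he
      rw [preceding_append_cons heσ]
      exact .inl ⟨α, hα, hs⟩
  | @cimp Δ α a σ τ hα _ hs hτ ih =>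
    obtain ⟨ρ, hρ, rfl⟩ := hτ
    obtain ⟨l, r, rfl, rfl⟩ := hρ.exists_split
    refine ⟨nodup_dedupRight _, Justified.dedupRight fun e he => ?_⟩
    have hsub : mkset (l ++ r) ⊆ mkset (l ++ a :: r) := by
      intro x hx
      simp only [mkset, Set.mem_ofPred_eq, List.mem_append, List.mem_cons] at hx ⊢
      tauto
    by_cases hea : e = a
    · subst hea
      exact .inr ⟨α, hα, hs.trans hsub⟩
    -- The extra fact `a` can only derive `a` itself, so every other element is already justified in
    -- `Δ`.
    · have := ih.2 e (by simpa [hea] using he)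
      rw [← Set.image_singleton, derives_union_facts, cderives_union_facts] at this
      rcases this with (h | h) | h
      · exact absurd h hea
      · exact .inl (h.mono (preceding_subset_insert _ _ hea))
      · exact .inr (h.mono hsub)

theorem proofTrace_of_forall_derives {Δ : HornTheory E} {σ : List E} (hσ : σ.Nodup)
    (h : ∀ e ∈ σ, Derives Δ (preceding σ e) e) : ProofTrace Δ σ := by
  induction σ using List.reverseRecOn with
  | nil => exact .nil Δ
  | append_singleton σ a ih =>
    have hσ' : σ.Nodup := (List.nodup_append.mp hσ).1
    have ha : a ∉ σ := fun ha => (List.nodup_append.mp hσ).2.2 a ha a (by simp) rfl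
    have hσa := ih hσ' fun e he => by
      have := h e (by simp [he])
      rwa [preceding_append_of_mem he] at this
    obtain ⟨α, hα, hs⟩ := h a (by simp)
    rw [preceding_append_cons ha] at hs
    have := ProofTrace.imp hα hσa hs
    rwa [concat, dedupRight_of_nodup hσ] at this

/-- Induction on a finite set `s` of elements still allowed a contractual justification, for all
theories at once: discharging one turns it into a fact of a larger theory. -/
theorem proofTrace_of_justified {Δ : HornTheory E} {σ : List E} (hσ : σ.Nodup)
    (h : Justified Δ σ) : ProofTrace Δ σ := by
  classical
  suffices H : ∀ (s : Finset E) (Δ : HornTheory E),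
      (∀ e ∈ σ, Derives Δ (preceding σ e) e ∨ e ∈ s ∧ CDerives Δ (mkset σ) e) →
      ProofTrace Δ σ from
    H σ.toFinset Δ fun e he => (h e he).imp_right fun hc => ⟨List.mem_toFinset.mpr he, hc⟩
  intro s
  induction s using Finset.induction_on with
  | empty =>
    intro Δ h
    exact proofTrace_of_forall_derives hσ fun e he => by simpa using h e he
  | insert c s _ ih =>
    intro Δ h
    by_cases hc : c ∈ σ ∧ CDerives Δ (mkset σ) c
    · obtain ⟨hcσ, α, hα, hs⟩ := hc
      -- Interleaving `c` at the very end leaves `σ` unchanged, since `c` already occurs in `σ` and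
      -- the late copy is erased.
      refine .cimp hα (ih _ fun e he => ?_) hs ⟨_, shuffle_concat σ c, ?_⟩
      · rw [← Set.image_singleton, derives_union_facts, cderives_union_facts]
        have := h e he
        rw [Finset.mem_insert] at this
        rw [Set.mem_singleton_iff]
        tauto
      · rw [dedupRight_concat_of_mem hcσ, dedupRight_of_nodup hσ]
    · refine ih Δ fun e he => (h e he).imp_right fun ⟨hes, hce⟩ => ⟨?_, hce⟩
      refine (Finset.mem_insert.mp hes).resolve_left ?_
      rintro rfl
      exact hc ⟨he, hce⟩

theorem proofTrace_iff {Δ : HornTheory E} {σ : List E} :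
    ProofTrace Δ σ ↔ σ.Nodup ∧ Justified Δ σ :=
  ⟨justified_of_proofTrace, fun h => proofTrace_of_justified h.1 h.2⟩

/-! ### Theories corresponding to event structures -/

namespace Corresponds

variable {𝓔 : CES E} {Δ : HornTheory E}

theorem enables_iff (h : Corresponds Δ 𝓔) {S : Set E} {e : E} :
    𝓔.Enables S e ↔ Derives Δ S e := by
  obtain ⟨hc, rfl⟩ := h
  constructor
  · rintro ⟨-, Y, hY, hYe⟩
    exact ⟨Y, .inl ⟨Y, e, hYe, rfl⟩, hY⟩
  · rintro ⟨α, ⟨Y, e', hYe, heq⟩ | ⟨Y, e', hYe, heq⟩, hα⟩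
    · cases heq
      exact ⟨fun x _ y _ => hc x y, α, hα, hYe⟩
    · cases heq

theorem cenables_iff (h : Corresponds Δ 𝓔) {S : Set E} {e : E} :
    𝓔.CEnables S e ↔ CDerives Δ S e := by
  obtain ⟨hc, rfl⟩ := h
  constructor
  · rintro ⟨-, Y, hY, hYe⟩
    exact ⟨Y, .inr ⟨Y, e, hYe, rfl⟩, hY⟩
  · rintro ⟨α, ⟨Y, e', hYe, heq⟩ | ⟨Y, e', hYe, heq⟩, hα⟩
    · cases heq
    · cases heq
      exact ⟨fun x _ y _ => hc x y, α, hα, hYe⟩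

theorem isPlay_iff (h : Corresponds Δ 𝓔) {σ : List E} : 𝓔.IsPlay σ ↔ σ.Nodup :=
  ⟨And.left, fun hσ => ⟨hσ, fun x _ y _ => h.1 x y⟩⟩

theorem credits_subset_iff (h : Corresponds Δ 𝓔) {σ : List E} (hσ : σ.Nodup) {X : Set E} :
    𝓔.credits σ ⊆ X ↔ Justified (Δ ∪ HornClause.fact '' X) σ := by
  constructor
  · intro hX e he
    obtain ⟨i, hi, rfl⟩ := List.mem_iff_getElem.mp he
    rw [derives_union_facts, cderives_union_facts, preceding_getElem hσ, ← h.enables_iff,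
      ← h.cenables_iff]
    by_contra! hn
    exact hn.1.1 (hX ⟨i, hi, rfl, hn.1.2, hn.2⟩)
  · rintro hJ _ ⟨i, hi, rfl, hn, hcn⟩
    have := hJ _ (List.getElem_mem hi)
    rw [derives_union_facts, cderives_union_facts, preceding_getElem hσ, ← h.enables_iff,
      ← h.cenables_iff] at this
    tauto

theorem proofTrace_iff_credits (h : Corresponds Δ 𝓔) {σ : List E} {X : Set E} :
    ProofTrace (Δ ∪ HornClause.fact '' X) σ ↔ 𝓔.IsPlay σ ∧ 𝓔.credits σ ⊆ X := by
  rw [proofTrace_iff, h.isPlay_iff]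
  exact and_congr_right fun hσ => (h.credits_subset_iff hσ).symm

end Corresponds

/-- Sequences that are justified up to the facts `X`, and start with a linearization of `X`,
can be merged into a single one. -/
theorem exists_justified_extension {Δ : HornTheory E} {X : Set E} {σ : List E} {a : E}
    (hX : mkset σ = X) (s : Finset E)
    (hs : ∀ y ∈ s, ∃ ρ η : List E, mkset ρ = X ∧ y ∈ ρ ++ η ∧
      Justified (Δ ∪ HornClause.fact '' X) (ρ ++ η)) :
    ∃ θ : List E, (s : Set E) ⊆ mkset (σ ++ [a] ++ θ) ∧
      ∀ e ∈ σ ++ [a] ++ θ, e = a ∨ Derives (Δ ∪ HornClause.fact '' X)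
        (preceding (σ ++ [a] ++ θ) e) e ∨
        CDerives (Δ ∪ HornClause.fact '' X) (mkset (σ ++ [a] ++ θ)) e := by
  classical
  induction s using Finset.induction_on with
  | empty =>
    refine ⟨[], by simp, fun e he => ?_⟩
    simp only [List.append_nil, List.mem_append, List.mem_singleton] at he
    refine he.symm.imp_right fun he => .inl (derives_union_facts.mpr (.inl ?_))
    rwa [← hX]
  | insert y s _ ih =>
    obtain ⟨θ, hθs, hθ⟩ := ih fun y hy => hs y (Finset.mem_insert_of_mem hy)
    obtain ⟨ρ, η, hρ, hy, hJ⟩ := hs y (Finset.mem_insert_self y s)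
    have hρσ : mkset ρ ⊆ mkset (σ ++ [a] ++ θ) := by
      rw [hρ, ← hX, List.append_assoc, mkset_append]
      exact Set.subset_union_left
    have hsub : mkset (ρ ++ η) ⊆ mkset (σ ++ [a] ++ (θ ++ η)) := by
      rw [← List.append_assoc, mkset_append, mkset_append]
      exact Set.union_subset_union_left _ hρσ
    refine ⟨θ ++ η, ?_, fun e he => ?_⟩
    · rw [Finset.coe_insert, Set.insert_subset_iff]
      refine ⟨hsub hy, hθs.trans ?_⟩
      rw [← List.append_assoc, mkset_append _ η]
      exact Set.subset_union_left
    · rw [← List.append_assoc] at he hsub ⊢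
      by_cases heθ : e ∈ σ ++ [a] ++ θ
      · refine (hθ e heθ).imp_right fun h => h.imp
          (·.mono (preceding_subset_append _ _ _)) (·.mono ?_)
        rw [mkset_append _ η]
        exact Set.subset_union_left
      · have heη : e ∈ η := (List.mem_append.mp he).resolve_left heθ
        refine .inr ((hJ e (List.mem_append_right _ heη)).imp (·.mono ?_) (·.mono hsub))
        -- `e` is new, so its first occurrence lies in `η` in both sequences, and the merged one
        -- only adds predecessors.
        rw [preceding_append_of_notMem heθ, preceding_append_of_notMem fun h => heθ (hρσ h)]
        exact Set.union_subset_union_left _ hρσ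

theorem Corresponds.urgent_subset_prudent {𝓔 : CES E} {Δ : HornTheory E}
    (h : Corresponds Δ 𝓔) (X : Set E) : urgent Δ X ⊆ 𝓔.prudent X := by
  rintro a ⟨haX, σ, θ, hσ, ht⟩
  refine ⟨haX, ?_⟩
  have hp := h.proofTrace_iff_credits.mp ht
  have hreach : mkset (σ ++ [a] ++ θ) ⊆ X ∪ 𝓔.reachable X := by
    intro e he
    by_cases heX : e ∈ X
    · exact .inl heX
    · rw [List.append_assoc] at he hp
      refine .inr ⟨heX, σ, [a] ++ θ, hp.1, hσ, ?_, hp.2⟩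
      exact (List.mem_append.mp he).resolve_left fun h => heX (hσ ▸ h)
  have haσ : a ∉ σ := fun h => haX (hσ ▸ h)
  have := (proofTrace_iff.mp ht).2 a (by simp)
  rw [derives_union_facts, cderives_union_facts, List.append_assoc, List.singleton_append,
    preceding_append_cons haσ, hσ] at this
  rw [List.append_assoc, List.singleton_append] at hreach
  rw [h.enables_iff, h.cenables_iff]
  rcases this with (ha | ha) | ha
  · exact absurd ha haX
  · exact .inl ha
  · exact .inr (ha.mono hreach)

theorem Corresponds.prudent_subset_urgent {𝓔 : CES E} {Δ : HornTheory E}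
    (h : Corresponds Δ 𝓔) {X : Set E} (hX : X.Finite) : 𝓔.prudent X ⊆ urgent Δ X := by
  rintro a ⟨haX, ha⟩
  obtain ⟨σ, hσn, hσ⟩ := exists_nodup_mkset_eq X hX
  have haσ : a ∉ σ := fun h => haX (hσ ▸ h)
  have hn : (σ ++ [a]).Nodup := by
    rw [← List.concat_eq_append]
    exact hσn.concat haσ
  suffices H : ∃ θ, Justified (Δ ∪ HornClause.fact '' X) (σ ++ [a] ++ θ) by
    obtain ⟨θ, hθ⟩ := H
    obtain ⟨θ', hθ'⟩ := dedupRight_append_of_nodup (r := θ) hn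
    refine ⟨haX, σ, θ', hσ, proofTrace_iff.mpr ?_⟩
    rw [← hθ']
    exact ⟨nodup_dedupRight _, hθ.dedupRight⟩
  rw [h.enables_iff, h.cenables_iff] at ha
  rcases ha with ha | ⟨Y, hYa, hY⟩
  · obtain ⟨θ, -, hθ⟩ := exists_justified_extension (Δ := Δ) (a := a) hσ ∅ (by simp)
    refine ⟨θ, fun e he => (hθ e he).elim ?_ id⟩
    rintro rfl
    rw [List.append_assoc, List.singleton_append, preceding_append_cons haσ, hσ]
    exact .inl (derives_union_facts.mpr (.inr ha))
  · obtain ⟨θ, hYθ, hθ⟩ := exists_justified_extension (Δ := Δ) (a := a) hσ Y fun y hy => by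
      rcases hY hy with hyX | ⟨-, ρ, η, hplay, hρ, hyη, hcr⟩
      -- A premise already in `X` needs no play beyond `σ`, whose elements are all facts.
      · refine ⟨σ, [], hσ, ?_, fun e he => .inl (derives_union_facts.mpr (.inl ?_))⟩
        · rw [List.append_nil]
          exact hσ.ge hyX
        · rw [List.append_nil] at he
          exact hσ.le he
      · exact ⟨ρ, η, hρ, List.mem_append_right _ hyη, (h.credits_subset_iff hplay.1).mp hcr⟩
    refine ⟨θ, fun e he => (hθ e he).elim ?_ id⟩
    rintro rfl
    exact .inr ⟨Y, .inl hYa, hYθ⟩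

end HornTheory

theorem mainTheorem7 {E : Type*} (𝓔 : CES E) (Δ : HornTheory E)
    (h : HornTheory.Corresponds Δ 𝓔) (X : Set E) (hX : X.Finite) :
    𝓔.prudent X = HornTheory.urgent Δ X :=
  (h.prudent_subset_urgent hX).antisymm (h.urgent_subset_prudent X)
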